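/- Let $k$ be an algebraically closed field and let $A = k[T]$ be the polynomial ring, viewed as a DG algebra concentrated in degree $0$ with zero differential (so that DG $A$-modules are complexes of $k[T]$-modules). Let $\mathsf{D}(A)$ be the derived category of DG $A$-modules, with suspension functor $\Sigma$, and let $\mathsf{T} = \langle k \rangle$ be the thick subcategory of $\mathsf{D}(A)$ generated by the trivial module $k = A/(T)$; it is the triangulated category generated by a $1$-spherical object. For each integer $r \geq 0$ let $X_r = A/(T^{r+1})$, viewed as an object of $\mathsf{T}$. Let $r \geq 0$ and let $u$ be an indecomposable object of $\mathsf{T}$. Then \[ \dim_k \operatorname{Hom}_{\mathsf{T}}(X_r,u) = \begin{cases} \min\{r,s\}+1 & \text{if } u \cong X_s \text{ or } u \cong \Sigma X_s \text{ for some } s \geq 0, \\ 0 & \text{for all other } u. \end{cases} \] -/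

import Mathlib

/-!
The triangulated category `T` generated by a `1`-spherical object over a field `k`.

The model of `T` generated by a `w`-spherical object is the thick subcategory `⟨k⟩` of the derived
category of DG modules over the DG algebra `A = k[T]` with zero differential, where the variable has
homological degree `d = w - 1` and `k = A / (T)` is the trivial DG module.  For `w = 1` we have
`d = 0`: the DG algebra `A` is the ordinary polynomial ring placed in degree zero, a DG `A`-module
is the same thing as a complex of `k[T]`-modules, and the derived category of DG `A`-modules is the
derived category of the abelian category of `k[T]`-modules.
-/

open CategoryTheory Limits

universe w u

namespace OneSpherical

noncomputable section

variable (k : Type u) [Field k]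

/-- The cyclic `k[T]`-module `k[T] / (T ^ (r + 1))`. -/
def quot (r : ℕ) : ModuleCat.{u} (Polynomial k) :=
  ModuleCat.of (Polynomial k)
    (Polynomial k ⧸ Ideal.span {(Polynomial.X : Polynomial k) ^ (r + 1)})

/-- The trivial module `k = k[T] / (T)`. -/
def triv : ModuleCat.{u} (Polynomial k) :=
  ModuleCat.of (Polynomial k) (Polynomial k ⧸ Ideal.span {(Polynomial.X : Polynomial k)})

/-- The map `k[T] / (T) → k[T] / (T ^ (r + 2))` given by multiplication by `T ^ (r + 1)`. -/
def incl (r : ℕ) : triv k ⟶ quot k (r + 1) :=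
  ModuleCat.ofHom (Submodule.mapQ _ _
    (LinearMap.mulLeft (Polynomial k) ((Polynomial.X : Polynomial k) ^ (r + 1))) (by
      refine Ideal.span_le.2 ?_
      rintro x rfl
      exact Ideal.mem_span_singleton.2 ⟨1, by simp [pow_succ, mul_assoc]⟩))

/-- The projection `k[T] / (T ^ (r + 2)) → k[T] / (T ^ (r + 1))`. -/
def proj (r : ℕ) : quot k (r + 1) ⟶ quot k r :=
  ModuleCat.ofHom (Submodule.mapQ _ _ LinearMap.id (by
      refine Ideal.span_le.2 ?_
      rintro x rfl
      exact Ideal.mem_span_singleton.2 ⟨Polynomial.X, by simp [pow_succ]⟩))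

lemma incl_proj (r : ℕ) : incl k r ≫ proj k r = 0 := by
  ext x
  obtain ⟨x, rfl⟩ := Submodule.Quotient.mk_surjective _ x
  exact (Submodule.Quotient.mk_eq_zero _).2 (Ideal.mem_span_singleton.2 ⟨x, rfl⟩)

lemma shortExact (r : ℕ) :
    (ShortComplex.mk (incl k r) (proj k r) (incl_proj k r)).ShortExact where
  exact := by
    rw [ShortComplex.moduleCat_exact_iff]
    intro x hx
    obtain ⟨x, rfl⟩ := Submodule.Quotient.mk_surjective _ x
    have hx' := (Submodule.Quotient.mk_eq_zero _).1 hx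
    obtain ⟨y, hy⟩ := Ideal.mem_span_singleton.1 hx'
    refine ⟨Submodule.Quotient.mk y, ?_⟩
    exact congrArg _ hy.symm
  mono_f := by
    rw [ModuleCat.mono_iff_injective]
    rw [injective_iff_map_eq_zero]
    intro x hx
    obtain ⟨x, rfl⟩ := Submodule.Quotient.mk_surjective _ x
    have hx' := (Submodule.Quotient.mk_eq_zero _).1 hx
    obtain ⟨y, hy⟩ := Ideal.mem_span_singleton.1 hx'
    refine (Submodule.Quotient.mk_eq_zero _).2 (Ideal.mem_span_singleton.2 ⟨y, ?_⟩)
    have h : (Polynomial.X : Polynomial k) ^ (r + 1) * x = Polynomial.X ^ (r + 1 + 1) * y := hy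
    rw [pow_succ _ (r + 1), mul_assoc] at h
    exact mul_left_cancel₀ (pow_ne_zero _ Polynomial.X_ne_zero) h
  epi_g := by
    rw [ModuleCat.epi_iff_surjective]
    intro x
    obtain ⟨x, rfl⟩ := Submodule.Quotient.mk_surjective _ x
    exact ⟨Submodule.Quotient.mk x, rfl⟩

variable [HasDerivedCategory.{w} (ModuleCat.{u} (Polynomial k))]

/-- The objects of the derived category `D(A)`, `A = k[T]`, that lie in the thick subcategory
generated by the trivial module `k`: those obtained from it by finitely many (de)suspensions,
finite direct sums, extensions and direct summands. -/
def thick : ObjectProperty (DerivedCategory (ModuleCat.{u} (Polynomial k))) :=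
  (ObjectProperty.singleton
    ((DerivedCategory.singleFunctor (ModuleCat.{u} (Polynomial k)) 0).obj (triv k))).triangEnvelope

instance : (thick k).IsStableUnderRetracts := by
  unfold thick; infer_instance

instance : (thick k).IsTriangulated := by
  unfold thick; infer_instance

/-- The category `T = ⟨k⟩`, a full subcategory of `D(A)`. -/
abbrev Cat := (thick k).FullSubcategory

lemma thick_triv :
    thick k ((DerivedCategory.singleFunctor (ModuleCat.{u} (Polynomial k)) 0).obj (triv k)) :=
  ObjectProperty.le_triangEnvelope _ _ (by simp)

lemma thick_quot (r : ℕ) :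
    thick k ((DerivedCategory.singleFunctor (ModuleCat.{u} (Polynomial k)) 0).obj (quot k r)) := by
  induction r with
  | zero =>
    have h : quot k 0 = triv k := by
      unfold quot triv
      rw [zero_add, pow_one]
    rw [h]
    exact thick_triv k
  | succ r ih =>
    exact ObjectProperty.ext_of_isTriangulatedClosed₂ _ _
      (shortExact k r).singleTriangle_distinguished (thick_triv k) ih

/-- The object `X_r = A / (T ^ (r + 1))` of `T`. -/
def X (r : ℕ) : Cat.{w} k :=
  ⟨(DerivedCategory.singleFunctor (ModuleCat.{u} (Polynomial k)) 0).obj (quot k r),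
    thick_quot k r⟩

/-- The suspension functor `Σ` of `T`. -/
abbrev suspension : Cat.{w} k ⥤ Cat.{w} k := shiftFunctor (Cat.{w} k) (1 : ℤ)

end

end OneSpherical

/-! The ring `k[T]` is a principal ideal domain, so finitely generated modules have two-term
projective resolutions. A complex with bounded, finitely generated homology is therefore the direct
sum of its shifted homology modules (`exists_isSplitMono_of_hasTwoTermResolution` extracts one
summand). Objects of `T` have such homology, killed elementwise by powers of `T`
(`finiteNilpotentHomology_of_thick`). By the structure theorem, an indecomposable with nonzero
homology in degree `n` is a cyclic module `k[T]/(T^(s+1))` placed there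
(`exists_iso_single_of_indecomposable`).

The resolution of `X_r` shows that maps `X_r ⟶ U` see only `H^0` and `H^(-1)` of `U`
(`eq_zero_of_hasTwoTermResolution`). In cohomological grading these are the degrees of `X_s` and `Σ
X_s`, so every other indecomposable receives only zero. The Hom spaces into `X_s` and `Σ X_s` are
the kernel and the cokernel of `T^(r+1)` on `k[T]/(T^(s+1))`, which have the same dimension
(`rank_hom_single`, `rank_hom_single_shift`). -/

/-! ### Derived maps out of a projective object -/

section ProjectiveObjects

open DerivedCategory

universe v u'

variable {C : Type u'} [Category.{v} C] [Abelian C]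

/-- A morphism from `P` to the homology of `K` lifts to a chain map from the single complex on a
projective object `P`. -/
lemma CochainComplex.exists_single_map_of_projective {P : C} [Projective P]
    (K : CochainComplex C ℤ) (n : ℤ) (f : P ⟶ K.homology n) :
    ∃ g : (HomologicalComplex.single C (ComplexShape.up ℤ) n).obj P ⟶ K,
      (HomologicalComplex.singleObjHomologySelfIso (ComplexShape.up ℤ) n P).inv ≫
        HomologicalComplex.homologyMap g n = f := by
  let z : P ⟶ K.cycles n := Projective.factorThru f (K.homologyπ n)
  have hz : z ≫ K.homologyπ n = f := Projective.factorThru_comp _ _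
  let g : (HomologicalComplex.single C (ComplexShape.up ℤ) n).obj P ⟶ K :=
    HomologicalComplex.mkHomFromSingle (z ≫ K.iCycles n) (by intro i _; simp)
  refine ⟨g, ?_⟩
  have h : (HomologicalComplex.singleObjCyclesSelfIso (ComplexShape.up ℤ) n P).inv ≫
      HomologicalComplex.cyclesMap g n = z := by
    rw [← cancel_mono (K.iCycles n)]
    simp [g]
  rw [← HomologicalComplex.singleObjCyclesSelfIso_inv_homologyπ, Category.assoc,
    HomologicalComplex.homologyπ_naturality, reassoc_of% h, hz]

/-- A chain map from the single complex on a projective object that vanishes in homology is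
null-homotopic. -/
lemma CochainComplex.nonempty_homotopy_zero_of_single_projective {P : C} [Projective P]
    (K : CochainComplex C ℤ) (n : ℤ)
    (g : (HomologicalComplex.single C (ComplexShape.up ℤ) n).obj P ⟶ K)
    (hg : HomologicalComplex.homologyMap g n = 0) : Nonempty (Homotopy g 0) := by
  let z := (HomologicalComplex.singleObjCyclesSelfIso (ComplexShape.up ℤ) n P).inv ≫
      HomologicalComplex.cyclesMap g n
  have hz : z ≫ K.homologyπ n = 0 := by
    simp only [z, Category.assoc, ← HomologicalComplex.homologyπ_naturality, hg, comp_zero]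
  have hex : (ShortComplex.mk (K.toCycles (n - 1) n) (K.homologyπ n) (by simp)).Exact :=
    ShortComplex.exact_of_g_is_cokernel _ (K.homologyIsCokernel (n - 1) n (by simp))
  -- The cycle vanishes in homology, so projectivity lifts it along the differential; this lift is
  -- the only component of the null-homotopy.
  let y : P ⟶ K.X (n - 1) := hex.liftFromProjective z hz
  have hy : y ≫ K.toCycles (n - 1) n = z := hex.liftFromProjective_comp z hz
  have hyd : y ≫ K.d (n - 1) n =
      (HomologicalComplex.singleObjXSelf (ComplexShape.up ℤ) n P).inv ≫ g.f n := by
    rw [← K.toCycles_i (n - 1) n, reassoc_of% hy]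
    simp [z]
  let α : HomComplex.Cochain ((CochainComplex.singleFunctor C n).obj P) K (-1) :=
    HomComplex.Cochain.fromSingleMk y (by lia)
  change (CochainComplex.singleFunctor C n).obj P ⟶ K at g
  change y ≫ K.d (n - 1) n =
      (HomologicalComplex.singleObjXSelf (ComplexShape.up ℤ) n P).inv ≫ g.f n at hyd
  refine ⟨(HomComplex.Cochain.equivHomotopy g 0).symm ⟨α, ?_⟩⟩
  rw [HomComplex.Cochain.δ_fromSingleMk y _ 0 n (by lia), hyd,
    HomComplex.Cochain.ofHom_zero, add_zero]
  apply (HomComplex.Cochain.fromSingleEquiv (add_zero n)).injective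
  rw [HomComplex.Cochain.fromSingleEquiv_fromSingleMk]
  simp [HomComplex.Cochain.fromSingleEquiv]

variable [HasDerivedCategory.{w} C]

/-- Every morphism in the derived category from a K-projective complex is represented by a chain
map. -/
lemma DerivedCategory.Q_map_surjective_of_isKProjective (S K : CochainComplex C ℤ)
    [S.IsKProjective] (f : Q.obj S ⟶ Q.obj K) : ∃ g : S ⟶ K, Q.map g = f := by
  obtain ⟨g', hg'⟩ := (CochainComplex.IsKProjective.Qh_map_bijective S
    ((HomotopyCategory.quotient _ _).obj K)).2
    ((quotientCompQhIso C).hom.app S ≫ f ≫ (quotientCompQhIso C).inv.app K)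
  obtain ⟨g, rfl⟩ := (HomotopyCategory.quotient _ _).map_surjective g'
  refine ⟨g, ?_⟩
  have h := (quotientCompQhIso C).hom.naturality g
  dsimp at h
  rw [hg'] at h
  simpa using h.symm

lemma DerivedCategory.Q_map_eq_zero_of_homotopy {S K : CochainComplex C ℤ} (g : S ⟶ K)
    (H : Homotopy g 0) : Q.map g = 0 := by
  have h0 := HomotopyCategory.eq_of_homotopy _ _ H
  rw [Functor.map_zero] at h0
  have h := (quotientCompQhIso C).hom.naturality g
  dsimp at h
  rw [h0, Functor.map_zero, zero_comp] at h
  rwa [eq_comm, Preadditive.IsIso.comp_left_eq_zero] at h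

lemma DerivedCategory.homologyMap_eq_zero_iff {S K : CochainComplex C ℤ} (g : S ⟶ K) (n : ℤ) :
    HomologicalComplex.homologyMap g n = 0 ↔ (homologyFunctor C n).map (Q.map g) = 0 := by
  change (HomologicalComplex.homologyFunctor C (ComplexShape.up ℤ) n).map g = 0 ↔ _
  have h : (homologyFunctor C n).map (Q.map g) ≫ (homologyFunctorFactors C n).hom.app K =
      (homologyFunctorFactors C n).hom.app S ≫
        (HomologicalComplex.homologyFunctor C (ComplexShape.up ℤ) n).map g :=
    homologyFunctorFactors_hom_naturality g n
  rw [← Preadditive.IsIso.comp_left_eq_zero ((homologyFunctorFactors C n).hom.app S) _, ← h]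
  exact Preadditive.IsIso.comp_right_eq_zero _ _

/-- A bounded above complex of projectives is K-projective. -/
instance CochainComplex.isKProjective_single (P : C) [Projective P] (n : ℤ) :
    ((CochainComplex.singleFunctor C n).obj P).IsKProjective := by
  have : ((CochainComplex.singleFunctor C n).obj P).IsStrictlyLE n := by
    dsimp [CochainComplex.singleFunctor, CochainComplex.singleFunctors]
    infer_instance
  have (i : ℤ) : Projective (((CochainComplex.singleFunctor C n).obj P).X i) := by
    by_cases hi : i = n
    · subst hi
      exact Projective.of_iso (HomologicalComplex.singleObjXSelf _ i P).symm inferInstance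
    · exact (HomologicalComplex.isZero_single_obj_X _ _ _ _ hi).projective
  exact CochainComplex.isKProjective_of_projective _ n

lemma DerivedCategory.eq_zero_of_homologyFunctor_map_eq_zero {P : C} [Projective P]
    (K : CochainComplex C ℤ) (n : ℤ)
    (f : Q.obj ((CochainComplex.singleFunctor C n).obj P) ⟶ Q.obj K)
    (hf : (homologyFunctor C n).map f = 0) : f = 0 := by
  obtain ⟨g, rfl⟩ := Q_map_surjective_of_isKProjective _ _ f
  obtain ⟨H⟩ := CochainComplex.nonempty_homotopy_zero_of_single_projective K n g
    ((homologyMap_eq_zero_iff g n).2 hf)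
  exact Q_map_eq_zero_of_homotopy g H

lemma DerivedCategory.exists_homologyFunctor_map_Q_map {P : C} [Projective P]
    (K : CochainComplex C ℤ) (n : ℤ)
    (f : (homologyFunctor C n).obj (Q.obj ((CochainComplex.singleFunctor C n).obj P)) ⟶
      (homologyFunctor C n).obj (Q.obj K)) :
    ∃ g : (CochainComplex.singleFunctor C n).obj P ⟶ K, (homologyFunctor C n).map (Q.map g) = f := by
  obtain ⟨g, hg⟩ := CochainComplex.exists_single_map_of_projective K n
    ((HomologicalComplex.singleObjHomologySelfIso (ComplexShape.up ℤ) n P).inv ≫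
      (homologyFunctorFactors C n).inv.app ((CochainComplex.singleFunctor C n).obj P) ≫
        f ≫ (homologyFunctorFactors C n).hom.app K)
  rw [cancel_epi] at hg
  change (CochainComplex.singleFunctor C n).obj P ⟶ K at g
  refine ⟨g, ?_⟩
  rw [← cancel_mono ((homologyFunctorFactors C n).hom.app K)]
  refine (homologyFunctorFactors_hom_naturality g n).trans ?_
  refine (congrArg (_ ≫ ·) hg).trans ?_
  exact Iso.hom_inv_id_app_assoc (homologyFunctorFactors C n) _ _

/-- After replacing `V` by a complex, K-projectivity turns derived maps into chain maps, which are
null-homotopic once zero on `H^n` and can realise any prescribed map there. -/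
lemma DerivedCategory.homologyFunctor_map_bijective_of_Q_single (P : C) [Projective P]
    (V : DerivedCategory C) (n : ℤ) :
    Function.Bijective (fun f : Q.obj ((CochainComplex.singleFunctor C n).obj P) ⟶ V ↦
      (homologyFunctor C n).map f) := by
  let e : Q.obj (Q.objPreimage V) ≅ V := Q.objObjPreimageIso V
  constructor
  · suffices ∀ f : Q.obj ((CochainComplex.singleFunctor C n).obj P) ⟶ V,
        (homologyFunctor C n).map f = 0 → f = 0 from
      fun f g h ↦ sub_eq_zero.1 (this _ (by rw [Functor.map_sub, sub_eq_zero]; exact h))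
    intro f hf
    have := eq_zero_of_homologyFunctor_map_eq_zero (Q.objPreimage V) n (f ≫ e.inv)
      (by rw [Functor.map_comp, hf, zero_comp])
    exact (Preadditive.IsIso.comp_right_eq_zero f e.inv).1 this
  · intro f
    obtain ⟨g, hg⟩ := exists_homologyFunctor_map_Q_map (Q.objPreimage V) n
      (f ≫ (homologyFunctor C n).map e.inv)
    refine ⟨Q.map g ≫ e.hom, ?_⟩
    dsimp only
    rw [Functor.map_comp, hg, Category.assoc, ← Functor.map_comp, e.inv_hom_id,
      CategoryTheory.Functor.map_id, Category.comp_id]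

/-- Morphisms in the derived category from a projective object in degree `n` correspond to
morphisms on homology. -/
lemma DerivedCategory.homologyFunctor_map_bijective_of_projective (P : C) [Projective P]
    (V : DerivedCategory C) (n : ℤ) :
    Function.Bijective (fun f : (singleFunctor C n).obj P ⟶ V ↦ (homologyFunctor C n).map f) :=
  homologyFunctor_map_bijective_of_Q_single P V n

end ProjectiveObjects

/-! ### Two-term resolutions and splitting off homology -/

section TwoTermResolutions

open DerivedCategory Pretriangulated

universe v u'

variable {C : Type u'} [Category.{v} C] [Abelian C]

/-- The property of having a projective resolution of length one. -/
def HasTwoTermResolution (M : C) : Prop :=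
  ∃ (S : ShortComplex C), S.ShortExact ∧ Projective S.X₁ ∧ Projective S.X₂ ∧ S.X₃ = M

variable [HasDerivedCategory.{w} C]

lemma DerivedCategory.isZero_homologyFunctor_single (M : C) {n m : ℤ} (h : m ≠ n) :
    IsZero ((homologyFunctor C m).obj ((singleFunctor C n).obj M)) := by
  obtain h | h := lt_or_gt_of_ne h
  · exact isZero_of_isGE _ n m h
  · exact isZero_of_isLE _ n m h

lemma DerivedCategory.isZero_homologyFunctor_shift_iff (V : DerivedCategory C) (a n m : ℤ)
    (h : a + n = m) :
    IsZero ((homologyFunctor C n).obj (V⟦a⟧)) ↔ IsZero ((homologyFunctor C m).obj V) :=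
  (((homologyFunctor C 0).shiftIso a n m h).app V).isZero_iff

lemma DerivedCategory.eq_zero_of_projective {P : C} [Projective P] {V : DerivedCategory C} {n : ℤ}
    (hV : IsZero ((homologyFunctor C n).obj V)) (f : (singleFunctor C n).obj P ⟶ V) : f = 0 :=
  (homologyFunctor_map_bijective_of_projective P V n).1 (hV.eq_of_tgt _ _)

lemma DerivedCategory.eq_zero_of_shift_projective {P : C} [Projective P] {V : DerivedCategory C}
    (hV : IsZero ((homologyFunctor C (-1)).obj V))
    (f : ((singleFunctor C 0).obj P)⟦(1 : ℤ)⟧ ⟶ V) : f = 0 := by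
  apply (shiftFunctor (DerivedCategory C) (-1 : ℤ)).map_injective
  rw [Functor.map_zero, ← cancel_epi ((shiftShiftNeg ((singleFunctor C 0).obj P) (1 : ℤ)).inv),
    comp_zero]
  exact eq_zero_of_projective ((isZero_homologyFunctor_shift_iff V (-1) 0 (-1) (by lia)).2 hV) _

/-- In the triangle `P₁ ⟶ P₀ ⟶ M ⟶ P₁⟦1⟧`, vanishing of `H^0` kills the restriction to `P₀`; the map
then factors through `P₁⟦1⟧`, from which vanishing of `H^(-1)` leaves only zero. -/
lemma DerivedCategory.eq_zero_of_hasTwoTermResolution {M : C} (hM : HasTwoTermResolution M)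
    {V : DerivedCategory C} (h₀ : IsZero ((homologyFunctor C 0).obj V))
    (h₁ : IsZero ((homologyFunctor C (-1)).obj V)) (f : (singleFunctor C 0).obj M ⟶ V) :
    f = 0 := by
  obtain ⟨S, hS, _, _, rfl⟩ := hM
  obtain ⟨g, rfl⟩ := Triangle.yoneda_exact₃ _ hS.singleTriangle_distinguished f
    (eq_zero_of_projective h₀ _)
  exact (congrArg _ (eq_zero_of_shift_projective h₁ g)).trans comp_zero

/-- Realise the composite `P₀ ⟶ M ⟶ H^0(V)` by a derived map. Its restriction to `P₁` is zero on
`H^0`, hence zero, so it extends over `M`; `P₀ ⟶ M` being epi identifies the extension on `H^0`. -/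
lemma DerivedCategory.homologyFunctor_zero_map_surjective {M : C} (hM : HasTwoTermResolution M)
    (V : DerivedCategory C) :
    Function.Surjective (fun f : (singleFunctor C 0).obj M ⟶ V ↦ (homologyFunctor C 0).map f) := by
  obtain ⟨S, hS, _, _, rfl⟩ := hM
  intro f
  obtain ⟨g₂, hg₂⟩ := (homologyFunctor_map_bijective_of_projective S.X₂ V 0).2
    ((homologyFunctor C 0).map ((singleFunctor C 0).map S.g) ≫ f)
  have h0 : (singleFunctor C 0).map S.f ≫ g₂ = 0 := by
    apply (homologyFunctor_map_bijective_of_projective S.X₁ V 0).1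
    dsimp only at hg₂ ⊢
    rw [Functor.map_comp, hg₂, ← Functor.map_comp_assoc, ← Functor.map_comp, S.zero,
      Functor.map_zero, Functor.map_zero, zero_comp, Functor.map_zero]
  obtain ⟨g, hg⟩ := Triangle.yoneda_exact₂ _ hS.singleTriangle_distinguished g₂ h0
  refine ⟨g, ?_⟩
  have : Epi S.g := hS.epi_g
  have : Epi ((homologyFunctor C 0).map ((singleFunctor C 0).map S.g)) :=
    ((MorphismProperty.epimorphisms C).arrow_mk_iso_iff
      ((Functor.mapArrowFunctor _ _ |>.mapIso (singleFunctorCompHomologyFunctorIso C 0)).app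
        (Arrow.mk S.g))).2 this
  rw [← cancel_epi ((homologyFunctor C 0).map ((singleFunctor C 0).map S.g))]
  refine Eq.trans ?_ hg₂
  rw [hg]
  exact (Functor.map_comp _ _ _).symm

lemma DerivedCategory.homologyFunctor_map_surjective {M : C} (hM : HasTwoTermResolution M)
    (V : DerivedCategory C) (n : ℤ) :
    Function.Surjective (fun f : (singleFunctor C n).obj M ⟶ V ↦ (homologyFunctor C n).map f) := by
  intro f
  let e : ((singleFunctor C n).obj M)⟦n⟧ ≅ (singleFunctor C 0).obj M :=
    ((singleFunctors C).shiftIso n 0 n (by lia)).app M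
  let s : shiftFunctor (DerivedCategory C) n ⋙ homologyFunctor C 0 ≅ homologyFunctor C n :=
    (homologyFunctor C 0).shiftIso n 0 n (by lia)
  obtain ⟨g, hg⟩ := homologyFunctor_zero_map_surjective hM (V⟦n⟧)
    ((homologyFunctor C 0).map e.inv ≫ s.hom.app _ ≫ f ≫ s.inv.app V)
  obtain ⟨g', hg'⟩ := (shiftFunctor (DerivedCategory C) n).map_surjective (e.hom ≫ g)
  refine ⟨g', ?_⟩
  dsimp only at hg ⊢
  have h : (homologyFunctor C 0).map (g'⟦n⟧') ≫ s.hom.app V =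
    s.hom.app ((singleFunctor C n).obj M) ≫ (homologyFunctor C n).map g' := s.hom.naturality g'
  rw [← cancel_epi (s.hom.app ((singleFunctor C n).obj M)), ← h, hg', Functor.map_comp, hg,
    Category.assoc]
  rw [Category.assoc]
  refine (e.map_hom_inv_id_assoc (homologyFunctor C 0) _).trans ?_
  rw [Category.assoc, Category.assoc, Iso.inv_hom_id_app]
  exact congrArg _ (Category.comp_id _)

/-- A bounded object of the derived category whose homology objects have two-term projective
resolutions admits each of its homology objects as a direct summand. -/
lemma DerivedCategory.exists_isSplitMono_of_hasTwoTermResolution (V : DerivedCategory C)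
    (hfin : {n | ¬ IsZero ((homologyFunctor C n).obj V)}.Finite)
    (hres : ∀ n, HasTwoTermResolution ((homologyFunctor C n).obj V)) (n : ℤ) :
    ∃ f : (singleFunctor C n).obj ((homologyFunctor C n).obj V) ⟶ V, IsSplitMono f := by
  by_cases hn : IsZero ((homologyFunctor C n).obj V)
  · exact ⟨0, ⟨⟨⟨0, (Functor.map_isZero _ hn).eq_of_src _ _⟩⟩⟩⟩
  let I := {n | ¬ IsZero ((homologyFunctor C n).obj V)}
  have : Finite I := hfin
  let F : I → DerivedCategory C :=
    fun i ↦ (singleFunctor C i.1).obj ((homologyFunctor C i.1).obj V)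
  -- Each `φ i` induces the canonical isomorphism on `H^i`, and its source has no other homology;
  -- hence their sum `Φ` is an isomorphism.
  choose φ hφ using fun i : I ↦ homologyFunctor_map_surjective (hres i.1) V i.1
    ((singleFunctorCompHomologyFunctorIso C i.1).hom.app _)
  let Φ : ⨁ F ⟶ V := biproduct.desc φ
  have hiso (i : I) : IsIso ((homologyFunctor C i.1).map (φ i)) := by
    have := hφ i
    dsimp only at this
    rw [this]
    infer_instance
  have := Fintype.ofFinite I
  have htotal (m : ℤ) : ∑ i : I, (homologyFunctor C m).map (biproduct.π F i) ≫
      (homologyFunctor C m).map (biproduct.ι F i) = 𝟙 _ := by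
    simp_rw [← Functor.map_comp]
    rw [← Functor.map_sum, biproduct.total, CategoryTheory.Functor.map_id]
  have hzero (m : ℤ) (i : I) (h : m ≠ i.1) : (homologyFunctor C m).map (biproduct.π F i) ≫
      (homologyFunctor C m).map (biproduct.ι F i) = 0 := by
    rw [(isZero_homologyFunctor_single _ h).eq_of_tgt
      ((homologyFunctor C m).map (biproduct.π F i)) 0, zero_comp]
  have : IsIso Φ := by
    rw [isIso_iff]
    intro m
    by_cases hm : IsZero ((homologyFunctor C m).obj V)
    · have hF : IsZero ((homologyFunctor C m).obj (⨁ F)) := by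
        rw [IsZero.iff_id_eq_zero, ← htotal]
        exact Finset.sum_eq_zero fun i _ ↦ hzero m i (by rintro rfl; exact i.2 hm)
      exact ⟨0, hF.eq_of_src _ _, hm.eq_of_src _ _⟩
    · let j : I := ⟨m, hm⟩
      have : IsIso ((homologyFunctor C m).map (biproduct.ι F j)) := by
        refine ⟨(homologyFunctor C m).map (biproduct.π F j), ?_, ?_⟩
        · rw [← Functor.map_comp, biproduct.ι_π_self, CategoryTheory.Functor.map_id]
        · rw [← htotal, Finset.sum_eq_single j]
          · intro i _ hi
            exact hzero m i fun h ↦ hi (Subtype.ext h.symm)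
          · simp
      have h2 : (homologyFunctor C m).map (biproduct.ι F j) ≫ (homologyFunctor C m).map Φ =
          (homologyFunctor C m).map (φ j) := by
        rw [← Functor.map_comp, biproduct.ι_desc]
      have := hiso j
      exact IsIso.of_isIso_fac_left h2
  refine ⟨φ ⟨n, hn⟩, ⟨⟨⟨inv Φ ≫ biproduct.π F ⟨n, hn⟩, ?_⟩⟩⟩⟩
  have : biproduct.ι F ⟨n, hn⟩ ≫ Φ = φ ⟨n, hn⟩ := biproduct.ι_desc _ _
  rw [← this, Category.assoc, IsIso.hom_inv_id_assoc, biproduct.ι_π_self]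

end TwoTermResolutions

/-! ### Finitely generated modules that are `T`-power torsion -/

namespace OneSpherical

open DerivedCategory Polynomial ZeroObject

section Modules

/-- Over a principal ideal domain the kernel of `R^n ⟶ M` is again free. -/
lemma hasTwoTermResolution_of_finite {R : Type u} [CommRing R] [IsDomain R] [IsPrincipalIdealRing R]
    (M : ModuleCat.{u} R) [Module.Finite R M] : HasTwoTermResolution M := by
  obtain ⟨n, f, hf⟩ := Module.Finite.exists_fin' R M
  refine ⟨ShortComplex.mk (ModuleCat.ofHom (LinearMap.ker f).subtype) (ModuleCat.ofHom f)
    (by ext x; exact x.2), ?_, ?_, ?_, rfl⟩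
  · exact {
      exact := by
        rw [ShortComplex.moduleCat_exact_iff]
        intro x hx
        exact ⟨⟨x, hx⟩, rfl⟩
      mono_f := by
        rw [ModuleCat.mono_iff_injective]
        exact Subtype.val_injective
      epi_g := by
        rw [ModuleCat.epi_iff_surjective]
        exact hf }
  · exact (IsProjective.iff_projective (LinearMap.ker f)).1 inferInstance
  · exact (IsProjective.iff_projective (Fin n → R)).1 inferInstance

variable (k : Type u) [Field k]

/-- Finitely generated modules on which every element is killed by a power of the variable. -/
def IsFiniteNilpotent (M : ModuleCat.{u} k[X]) : Prop :=
  IsNoetherian k[X] M ∧ ∀ x : M, ∃ m : ℕ, (Polynomial.X : k[X]) ^ m • x = 0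

variable {k}

lemma IsFiniteNilpotent.of_exact {S : ShortComplex (ModuleCat.{u} k[X])} (hS : S.Exact)
    (h₁ : IsFiniteNilpotent k S.X₁) (h₃ : IsFiniteNilpotent k S.X₃) :
    IsFiniteNilpotent k S.X₂ := by
  have := h₁.1
  have := h₃.1
  refine ⟨isNoetherian_of_range_eq_ker S.f.hom S.g.hom hS.moduleCat_range_eq_ker, fun x ↦ ?_⟩
  obtain ⟨m, hm⟩ := h₃.2 (S.g.hom x)
  rw [← map_smul] at hm
  obtain ⟨y, hy⟩ := (ShortComplex.moduleCat_exact_iff S).1 hS _ hm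
  obtain ⟨l, hl⟩ := h₁.2 y
  refine ⟨l + m, ?_⟩
  rw [pow_add, mul_smul, ← hy]
  exact (map_smul S.f.hom _ _).symm.trans (by rw [hl, map_zero])

lemma IsFiniteNilpotent.of_isZero {M : ModuleCat.{u} k[X]} (hM : IsZero M) :
    IsFiniteNilpotent k M := by
  have := ModuleCat.subsingleton_of_isZero hM
  exact ⟨inferInstance, fun x ↦ ⟨0, Subsingleton.elim _ _⟩⟩

lemma IsFiniteNilpotent.of_mono {M N : ModuleCat.{u} k[X]} (f : M ⟶ N) [Mono f]
    (hN : IsFiniteNilpotent k N) : IsFiniteNilpotent k M :=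
  of_exact (S := ShortComplex.mk (0 : (0 : ModuleCat.{u} k[X]) ⟶ M) f Limits.zero_comp)
    ((ShortComplex.exact_iff_mono _ rfl).2 inferInstance) (.of_isZero (isZero_zero _)) hN

lemma isFiniteNilpotent_triv : IsFiniteNilpotent k (triv k) := by
  refine ⟨inferInstanceAs (IsNoetherian k[X] (k[X] ⧸ Ideal.span {(Polynomial.X : k[X])})),
    fun x ↦ ⟨1, ?_⟩⟩
  obtain ⟨x, rfl⟩ := Submodule.Quotient.mk_surjective _ x
  exact (Submodule.Quotient.mk_eq_zero _).2 (Ideal.mem_span_singleton.2 ⟨x, by simp⟩)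

/-- A nonzero finitely generated nilpotent module has a direct summand `k[T] / (T ^ (s + 1))`. -/
lemma IsFiniteNilpotent.exists_isSplitMono {M : ModuleCat.{u} k[X]} (hM : IsFiniteNilpotent k M)
    (h0 : ¬ IsZero M) : ∃ (s : ℕ) (f : quot k s ⟶ M), IsSplitMono f := by
  have := hM.1
  obtain ⟨d, a, ⟨e⟩⟩ := Module.torsion_by_prime_power_decomposition
    (Polynomial.irreducible_X (R := k)) (M := M) (fun {x} ↦ by
      obtain ⟨m, hm⟩ := hM.2 x
      exact ⟨⟨_, m, rfl⟩, hm⟩)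
  -- If all exponents were zero, every summand would vanish, and `M` with them.
  obtain ⟨i, hi⟩ : ∃ i, a i ≠ 0 := by
    by_contra! h
    apply h0
    have (i : Fin d) : Subsingleton (k[X] ⧸ Submodule.span k[X] {(Polynomial.X : k[X]) ^ a i}) := by
      rw [Submodule.Quotient.subsingleton_iff, h i, pow_zero]
      exact Ideal.span_singleton_one
    have : Subsingleton (DirectSum (Fin d)
        fun i ↦ k[X] ⧸ Submodule.span k[X] {(Polynomial.X : k[X]) ^ a i}) :=
      ⟨fun x y ↦ DFinsupp.ext fun i ↦ Subsingleton.elim _ _⟩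
    have := e.toEquiv.subsingleton
    exact ModuleCat.isZero_of_subsingleton M
  obtain ⟨s, hs⟩ := Nat.exists_eq_succ_of_ne_zero hi
  let c : (k[X] ⧸ Ideal.span {(Polynomial.X : k[X]) ^ (s + 1)}) ≃ₗ[k[X]]
      k[X] ⧸ Submodule.span k[X] {(Polynomial.X : k[X]) ^ a i} :=
    Submodule.quotEquivOfEq _ _ (by rw [hs])
  refine ⟨s, ModuleCat.ofHom (e.symm.toLinearMap ∘ₗ DirectSum.lof k[X] (Fin d) _ i ∘ₗ
      c.toLinearMap),
    ⟨⟨⟨ModuleCat.ofHom (c.symm.toLinearMap ∘ₗ DirectSum.component k[X] (Fin d) _ i ∘ₗ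
      e.toLinearMap), ?_⟩⟩⟩⟩
  ext x
  change c.symm (DirectSum.component k[X] (Fin d) _ i
    (e (e.symm (DirectSum.lof k[X] (Fin d) _ i (c x))))) = x
  rw [e.apply_symm_apply, DirectSum.component.lof_self]
  exact c.symm_apply_apply x

end Modules

/-! ### Homology of the objects of `T` -/

section Homology

variable (k : Type u) [Field k] [HasDerivedCategory.{w} (ModuleCat.{u} (Polynomial k))]

/-- Objects of the derived category with bounded, finitely generated and nilpotent homology. -/
def finiteNilpotentHomology : ObjectProperty (DerivedCategory (ModuleCat.{u} k[X])) :=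
  fun V ↦ {n | ¬ IsZero ((homologyFunctor _ n).obj V)}.Finite ∧
    ∀ n, IsFiniteNilpotent k ((homologyFunctor _ n).obj V)

variable {k} in
lemma finiteNilpotentHomology_of_exact {V₁ V₂ V₃ : DerivedCategory (ModuleCat.{u} k[X])}
    (f : V₁ ⟶ V₂) (g : V₂ ⟶ V₃) (w : f ≫ g = 0)
    (h : ∀ n, ((ShortComplex.mk f g w).map (homologyFunctor _ n)).Exact)
    (h₁ : finiteNilpotentHomology k V₁) (h₃ : finiteNilpotentHomology k V₃) :
    finiteNilpotentHomology k V₂ := by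
  refine ⟨(h₁.1.union h₃.1).subset fun n hn ↦ ?_, fun n ↦ (h₁.2 n).of_exact (h n) (h₃.2 n)⟩
  by_contra! hn'
  simp only [Set.mem_union, Set.mem_ofPred_eq, not_or, not_not] at hn'
  refine hn ?_
  exact (h n).isZero_of_both_zeros (hn'.1.eq_of_src _ _) (hn'.2.eq_of_tgt _ _)

lemma finiteNilpotentHomology_zero {V : DerivedCategory (ModuleCat.{u} k[X])} (hV : IsZero V) :
    finiteNilpotentHomology k V := by
  have h (n : ℤ) := (homologyFunctor (ModuleCat.{u} k[X]) n).map_isZero hV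
  exact ⟨by simp [h], fun n ↦ .of_isZero (h n)⟩

instance : (finiteNilpotentHomology k).IsStableUnderRetracts where
  of_retract r hY := by
    refine finiteNilpotentHomology_of_exact (0 : (0 : DerivedCategory (ModuleCat.{u} k[X])) ⟶ _) r.i
      Limits.zero_comp (fun n ↦ ?_)
      (finiteNilpotentHomology_zero k (isZero_zero _)) hY
    have : Mono ((homologyFunctor (ModuleCat.{u} k[X]) n).map r.i) :=
      (r.map (homologyFunctor (ModuleCat.{u} k[X]) n)).splitMono.mono
    exact (ShortComplex.exact_iff_mono _ (Functor.map_zero _ _ _)).2 this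

instance : (finiteNilpotentHomology k).IsTriangulated where
  exists_zero := ⟨0, isZero_zero _, finiteNilpotentHomology_zero k (isZero_zero _)⟩
  isStableUnderShiftBy a := ⟨fun V hV ↦ by
    let e (n : ℤ) : (homologyFunctor _ n).obj (V⟦a⟧) ≅ (homologyFunctor _ (a + n)).obj V :=
      ((homologyFunctor (ModuleCat.{u} k[X]) 0).shiftIso a n (a + n) rfl).app V
    refine ⟨?_, fun n ↦ .of_mono (N := (homologyFunctor _ (a + n)).obj V) (e n).hom (hV.2 (a + n))⟩
    refine (hV.1.preimage (add_right_injective a).injOn).subset fun n hn ↦ ?_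
    exact fun h ↦ hn ((e n).isZero_iff.2 h)⟩
  ext₂' T hT h₁ h₃ := ObjectProperty.le_isoClosure _ _
    (finiteNilpotentHomology_of_exact T.mor₁ T.mor₂
      (Pretriangulated.comp_distTriang_mor_zero₁₂ T hT)
      (fun n ↦ HomologySequence.exact₂ T hT n) h₁ h₃)

variable {k} in
lemma finiteNilpotentHomology_single {M : ModuleCat.{u} k[X]} (hM : IsFiniteNilpotent k M) (m : ℤ) :
    finiteNilpotentHomology k ((singleFunctor (ModuleCat.{u} k[X]) m).obj M) := by
  have h (n : ℤ) (hn : n ≠ m) : IsZero ((homologyFunctor (ModuleCat.{u} k[X]) n).obj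
      ((singleFunctor (ModuleCat.{u} k[X]) m).obj M)) := isZero_homologyFunctor_single M hn
  have h' (n : ℤ) : IsFiniteNilpotent k ((homologyFunctor (ModuleCat.{u} k[X]) n).obj
      ((singleFunctor (ModuleCat.{u} k[X]) m).obj M)) := by
    by_cases hn : n = m
    · subst hn
      let e : (homologyFunctor (ModuleCat.{u} k[X]) n).obj
        ((singleFunctor (ModuleCat.{u} k[X]) n).obj M) ≅ M :=
          (singleFunctorCompHomologyFunctorIso (ModuleCat.{u} k[X]) n).app M
      exact .of_mono e.hom hM
    · exact .of_isZero (h n hn)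
  exact ⟨(Set.finite_singleton m).subset fun n hn ↦ by_contra fun hnm ↦ hn (h n hnm), h'⟩

/-- The homological condition is stable under triangles, shifts and retracts, so it need only be
checked on the generator. -/
lemma finiteNilpotentHomology_of_thick {V : DerivedCategory (ModuleCat.{u} k[X])}
    (hV : thick k V) : finiteNilpotentHomology k V := by
  refine (ObjectProperty.triangEnvelope_le_iff _).2 ?_ V hV
  rw [ObjectProperty.singleton_le_iff]
  exact finiteNilpotentHomology_single isFiniteNilpotent_triv 0

end Homology

end OneSpherical

/-! ### Classification of the indecomposable objects -/

section Indecomposable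

open Pretriangulated

/-- The cone of a split mono is a complementary summand, and indecomposability makes it zero. -/
lemma CategoryTheory.Indecomposable.isIso_of_isSplitMono {C : Type*} [Category* C]
    [HasZeroObject C] [HasShift C ℤ] [Preadditive C] [∀ n : ℤ, (shiftFunctor C n).Additive]
    [Pretriangulated C] {Y U : C} (hU : Indecomposable U) (hY : ¬ IsZero Y) (f : Y ⟶ U)
    [IsSplitMono f] : IsIso f := by
  obtain ⟨Z, g, h, mem⟩ := distinguished_cocone_triangle f
  have h0 : (Triangle.mk f g h).mor₃ = 0 :=
    Triangle.mor₃_eq_zero_of_mono₁ _ mem (inferInstanceAs (Mono f))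
  obtain ⟨e, -, -⟩ := exists_iso_binaryBiproduct_of_distTriang _ mem h0
  have hZ := (hU.2 _ _ e).resolve_left hY
  exact (Triangle.isZero₃_iff_isIso₁ _ mem).1 hZ

end Indecomposable

namespace OneSpherical

open DerivedCategory Polynomial

section Classification

variable {k : Type u} [Field k]

lemma not_isZero_quot (s : ℕ) : ¬ IsZero (quot k s) := by
  intro h
  have := ModuleCat.subsingleton_of_isZero h
  change Subsingleton (k[X] ⧸ Ideal.span {(Polynomial.X : k[X]) ^ (s + 1)}) at this
  rw [Ideal.Quotient.subsingleton_iff, Ideal.span_singleton_eq_top,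
    isUnit_pow_iff (Nat.succ_ne_zero s)] at this
  exact Polynomial.not_isUnit_X this

lemma hasTwoTermResolution_quot (r : ℕ) : HasTwoTermResolution (quot k r) := by
  have : Module.Finite k[X] (quot k r) :=
    inferInstanceAs (Module.Finite k[X] (k[X] ⧸ Ideal.span {(Polynomial.X : k[X]) ^ (r + 1)}))
  exact hasTwoTermResolution_of_finite _

variable [HasDerivedCategory.{w} (ModuleCat.{u} (Polynomial k))]

/-- Every indecomposable object with nonzero homology in degree `n` is a cyclic module placed in
degree `n`. -/
lemma exists_iso_single_of_indecomposable (U : Cat.{w} k) (hU : Indecomposable U) (n : ℤ)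
    (hn : ¬ IsZero ((homologyFunctor (ModuleCat.{u} k[X]) n).obj U.obj)) :
    ∃ s, Nonempty ((singleFunctor (ModuleCat.{u} k[X]) n).obj (quot k s) ≅ U.obj) := by
  have hV := finiteNilpotentHomology_of_thick k U.property
  obtain ⟨f, hf⟩ := exists_isSplitMono_of_hasTwoTermResolution U.obj hV.1 (fun m ↦ by
    have := (hV.2 m).1
    exact hasTwoTermResolution_of_finite _) n
  obtain ⟨s, g, hg⟩ := (hV.2 n).exists_isSplitMono hn
  refine ⟨s, ?_⟩
  let F := singleFunctor (ModuleCat.{u} k[X]) n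
  let i : F.obj (quot k s) ⟶ U.obj := F.map g ≫ f
  let r : U.obj ⟶ F.obj (quot k s) := retraction f ≫ F.map (retraction g)
  have hir : i ≫ r = 𝟙 _ := by
    simp only [i, r, Category.assoc, IsSplitMono.id_assoc, ← Functor.map_comp, IsSplitMono.id,
      CategoryTheory.Functor.map_id]
  -- Indecomposability of `U` concerns decompositions inside `T`, so the summand must first be shown
  -- to lie there.
  have hY : thick k (F.obj (quot k s)) :=
    ObjectProperty.prop_of_retract _ ⟨i, r, hir⟩ U.property
  let Y : Cat.{w} k := ⟨_, hY⟩
  let i' : Y ⟶ U := ObjectProperty.homMk i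
  have : IsSplitMono i' := ⟨⟨⟨ObjectProperty.homMk r, by ext; exact hir⟩⟩⟩
  have hY0 : ¬ IsZero Y := fun h ↦ not_isZero_quot (k := k) s
    (IsZero.of_iso ((homologyFunctor (ModuleCat.{u} k[X]) n).map_isZero ((thick k).ι.map_isZero h))
      ((singleFunctorCompHomologyFunctorIso (ModuleCat.{u} k[X]) n).app (quot k s)).symm)
  have := hU.isIso_of_isSplitMono hY0 i'
  exact ⟨(thick k).ι.mapIso (asIso i')⟩

lemma exists_iso_X_of_indecomposable (U : Cat.{w} k) (hU : Indecomposable U)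
    (h0 : ¬ IsZero ((homologyFunctor (ModuleCat.{u} k[X]) 0).obj U.obj)) :
    ∃ s, Nonempty (U ≅ X k s) := by
  obtain ⟨s, ⟨e⟩⟩ := exists_iso_single_of_indecomposable U hU 0 h0
  exact ⟨s, ⟨(thick k).fullyFaithfulι.preimageIso e.symm⟩⟩

/-- The underlying object of `Σ X_s`. -/
noncomputable def suspensionXIso (s : ℕ) : ((suspension k).obj (X.{w} k s)).obj ≅
    ((singleFunctor (ModuleCat.{u} k[X]) 0).obj (quot k s))⟦(1 : ℤ)⟧ :=
  ((thick k).ι.commShiftIso (1 : ℤ)).app (X k s)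

lemma exists_iso_suspension_X_of_indecomposable (U : Cat.{w} k) (hU : Indecomposable U)
    (h1 : ¬ IsZero ((homologyFunctor (ModuleCat.{u} k[X]) (-1)).obj U.obj)) :
    ∃ s, Nonempty (U ≅ (suspension k).obj (X k s)) := by
  obtain ⟨s, ⟨e⟩⟩ := exists_iso_single_of_indecomposable U hU (-1) h1
  exact ⟨s, ⟨(thick k).fullyFaithfulι.preimageIso (e.symm ≪≫
    (((singleFunctors (ModuleCat.{u} k[X])).shiftIso 1 (-1) 0 (by lia)).app (quot k s)).symm ≪≫
      (suspensionXIso s).symm)⟩⟩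

lemma hom_eq_zero_of_indecomposable (r : ℕ) (U : Cat.{w} k) (hU : Indecomposable U)
    (h : ∀ s : ℕ, ¬ Nonempty (U ≅ X k s) ∧ ¬ Nonempty (U ≅ (suspension k).obj (X k s)))
    (f : X k r ⟶ U) : f = 0 := by
  apply (thick k).ι.map_injective
  refine eq_zero_of_hasTwoTermResolution (hasTwoTermResolution_quot r) ?_ ?_ _
  · by_contra h0
    obtain ⟨s, hs⟩ := exists_iso_X_of_indecomposable U hU h0
    exact (h s).1 hs
  · by_contra h1
    obtain ⟨s, hs⟩ := exists_iso_suspension_X_of_indecomposable U hU h1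
    exact (h s).2 hs

end Classification

end OneSpherical

/-! ### Kernel and cokernel of `T^(r+1)` on truncated polynomials -/

section LinearAlgebra

variable {k V W : Type*} [Field k] [AddCommGroup V] [Module k V] [AddCommGroup W] [Module k W]
  [Module.Finite k V]

lemma Module.finite_and_finrank_of_ker (a : V →ₗ[k] V) (j : W →ₗ[k] V)
    (hj : Function.Injective j) (hja : LinearMap.range j = LinearMap.ker a) :
    Module.Finite k W ∧ Module.finrank k W + Module.finrank k (LinearMap.range a) =
      Module.finrank k V := by
  refine ⟨Module.Finite.of_injective j hj, ?_⟩
  rw [← LinearMap.finrank_range_of_inj hj, hja, add_comm, LinearMap.finrank_range_add_finrank_ker]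

lemma Module.finite_and_finrank_of_coker (a : V →ₗ[k] V) (p : V →ₗ[k] W)
    (hp : Function.Surjective p) (hpa : LinearMap.ker p = LinearMap.range a) :
    Module.Finite k W ∧ Module.finrank k W + Module.finrank k (LinearMap.range a) =
      Module.finrank k V := by
  refine ⟨Module.Finite.of_surjective p hp, ?_⟩
  rw [← hpa, ← LinearMap.finrank_range_add_finrank_ker p, LinearMap.range_eq_top.2 hp, finrank_top]

end LinearAlgebra

namespace OneSpherical

open DerivedCategory Polynomial

section TruncatedPolynomials

variable (k : Type u) [Field k]

lemma finrank_quotient_X_pow (s : ℕ) :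
    Module.finrank k (k[X] ⧸ Ideal.span {(Polynomial.X : k[X]) ^ s}) = s := by
  rw [finrank_quotient_span_eq_natDegree, natDegree_X_pow]

/-- Multiplication by `T ^ (r + 1)` on `k[T] / (T ^ (s + 1))`. -/
noncomputable def mulXPow (r s : ℕ) :
    (k[X] ⧸ Ideal.span {(Polynomial.X : k[X]) ^ (s + 1)}) →ₗ[k]
      k[X] ⧸ Ideal.span {(Polynomial.X : k[X]) ^ (s + 1)} :=
  LinearMap.mulLeft k (Ideal.Quotient.mk _ (Polynomial.X ^ (r + 1)))

instance (s : ℕ) : Module.Finite k (k[X] ⧸ Ideal.span {(Polynomial.X : k[X]) ^ (s + 1)}) :=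
  (Polynomial.monic_X_pow (s + 1)).finite_quotient

/-- The image of `T^(r+1)` is the kernel of the projection onto `k[T]/(T^(min r s + 1))`. -/
lemma finrank_range_mulXPow (r s : ℕ) :
    (min r s + 1) + Module.finrank k (LinearMap.range (mulXPow k r s)) = s + 1 := by
  let I := Ideal.span {(Polynomial.X : k[X]) ^ (s + 1)}
  let J := Ideal.span {(Polynomial.X : k[X]) ^ (min r s + 1)}
  have hIJ : I ≤ J := Ideal.span_singleton_le_span_singleton.2 (pow_dvd_pow _ (by omega))
  let p : (k[X] ⧸ I) →ₗ[k] k[X] ⧸ J := (Ideal.Quotient.factorₐ k hIJ).toLinearMap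
  have hp : Function.Surjective p := Ideal.Quotient.factor_surjective hIJ
  have hker : LinearMap.ker p = LinearMap.range (mulXPow k r s) := by
    ext x
    obtain ⟨x, rfl⟩ := Ideal.Quotient.mk_surjective x
    have h1 : Ideal.Quotient.mk I x ∈ LinearMap.ker p ↔ Polynomial.X ^ (min r s + 1) ∣ x := by
      rw [← Ideal.mem_span_singleton]
      exact Ideal.Quotient.eq_zero_iff_mem
    have h2 : Ideal.Quotient.mk I x ∈ LinearMap.range (mulXPow k r s) ↔
        ∃ y z : k[X], x = Polynomial.X ^ (r + 1) * y + Polynomial.X ^ (s + 1) * z := by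
      constructor
      · rintro ⟨y, hy⟩
        obtain ⟨y, rfl⟩ := Ideal.Quotient.mk_surjective y
        obtain ⟨z, hz⟩ := Ideal.mem_span_singleton.1 (Ideal.Quotient.eq.1
          (show Ideal.Quotient.mk I x = Ideal.Quotient.mk I (Polynomial.X ^ (r + 1) * y) from
            hy.symm))
        exact ⟨y, z, by rw [← hz]; ring⟩
      · rintro ⟨y, z, rfl⟩
        refine ⟨Ideal.Quotient.mk I y, ?_⟩
        change Ideal.Quotient.mk I (Polynomial.X ^ (r + 1) * y) = _
        rw [Ideal.Quotient.eq]
        exact Ideal.mem_span_singleton.2 ⟨-z, by ring⟩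
    rw [h1, h2]
    constructor
    · rintro ⟨y, rfl⟩
      obtain h | h := le_total r s
      · exact ⟨y, 0, by simp [h]⟩
      · exact ⟨0, y, by simp [h]⟩
    · rintro ⟨y, z, rfl⟩
      exact dvd_add (Dvd.dvd.mul_right (pow_dvd_pow _ (by omega)) _)
        (Dvd.dvd.mul_right (pow_dvd_pow _ (by omega)) _)
  have := (Module.finite_and_finrank_of_coker (mulXPow k r s) p hp hker).2
  rwa [finrank_quotient_X_pow, finrank_quotient_X_pow] at this

end TruncatedPolynomials

/-! ### Hom spaces from the resolution of `X_r` -/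

open Pretriangulated

section Resolution

variable (k : Type u) [Field k]

/-- The polynomial ring as a module over itself. -/
noncomputable def poly : ModuleCat.{u} k[X] := ModuleCat.of k[X] k[X]

instance : Projective (poly k) := (IsProjective.iff_projective k[X]).1 inferInstance

/-- Multiplication by `T ^ (r + 1)` on the polynomial ring. -/
noncomputable def polyMul (r : ℕ) : poly k ⟶ poly k :=
  ModuleCat.ofHom (LinearMap.mulLeft k[X] (Polynomial.X ^ (r + 1)))

/-- The projection `k[T] → k[T] / (T ^ (r + 1))`. -/
noncomputable def polyProj (r : ℕ) : poly k ⟶ quot k r :=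
  ModuleCat.ofHom (Submodule.mkQ _)

lemma polyMul_polyProj (r : ℕ) : polyMul k r ≫ polyProj k r = 0 := by
  ext
  exact (Submodule.Quotient.mk_eq_zero _).2 (Ideal.mem_span_singleton.2 ⟨_, rfl⟩)

instance (r : ℕ) : Epi (polyProj k r) := by
  rw [ModuleCat.epi_iff_surjective]
  exact Submodule.mkQ_surjective _

lemma poly_shortExact (r : ℕ) :
    (ShortComplex.mk (polyMul k r) (polyProj k r) (polyMul_polyProj k r)).ShortExact where
  exact := by
    rw [ShortComplex.moduleCat_exact_iff]
    intro x hx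
    obtain ⟨y, hy⟩ := Ideal.mem_span_singleton.1 ((Submodule.Quotient.mk_eq_zero _).1 hx)
    exact ⟨y, hy.symm⟩
  mono_f := by
    rw [ModuleCat.mono_iff_injective]
    exact mul_right_injective₀ (M₀ := k[X]) (pow_ne_zero _ Polynomial.X_ne_zero)

/-- Evaluation at `1` identifies module maps `k[T] → k[T] / (T ^ (s + 1))` with elements. -/
noncomputable def polyHomEquiv (s : ℕ) : (poly k ⟶ quot k s) ≃ₗ[k]
    k[X] ⧸ Ideal.span {(Polynomial.X : k[X]) ^ (s + 1)} :=
  LinearEquiv.ofBijective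
    { toFun f := f.hom (1 : k[X])
      map_add' f g := rfl
      map_smul' c f := algebraMap_smul k[X] c
        (show k[X] ⧸ Ideal.span {(Polynomial.X : k[X]) ^ (s + 1)} from f.hom (1 : k[X])) }
    ⟨fun f g h ↦ by
      ext
      exact h, fun x ↦ ⟨ModuleCat.ofHom (LinearMap.toSpanSingleton k[X] _ x),
        LinearMap.toSpanSingleton_apply_one _ _ _⟩⟩

lemma polyHomEquiv_comp (r s : ℕ) (f : poly k ⟶ quot k s) :
    polyHomEquiv k s (polyMul k r ≫ f) = mulXPow k r s (polyHomEquiv k s f) := by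
  have h : (polyMul k r ≫ f).hom (1 : k[X]) =
      (Polynomial.X ^ (r + 1) : k[X]) • f.hom (1 : k[X]) :=
    map_smul f.hom (Polynomial.X ^ (r + 1) : k[X]) (1 : k[X])
  refine h.trans ?_
  exact Algebra.smul_def (A := k[X] ⧸ Ideal.span {(Polynomial.X : k[X]) ^ (s + 1)})
    (Polynomial.X ^ (r + 1) : k[X]) (polyHomEquiv k s f)

variable [HasDerivedCategory.{w} (ModuleCat.{u} (Polynomial k))]

/-- The embedding in degree zero as a linear equivalence on morphisms. -/
noncomputable def singleHomEquiv (M N : ModuleCat.{u} k[X]) : (M ⟶ N) ≃ₗ[k]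
    ((singleFunctor (ModuleCat.{u} k[X]) 0).obj M ⟶ (singleFunctor (ModuleCat.{u} k[X]) 0).obj N) :=
  LinearEquiv.ofBijective ((singleFunctor (ModuleCat.{u} k[X]) 0).mapLinearMap k)
    ⟨(singleFunctor (ModuleCat.{u} k[X]) 0).map_injective,
      (singleFunctor (ModuleCat.{u} k[X]) 0).map_surjective⟩

/-- Morphisms from `k[T]` to `k[T] / (T ^ (s + 1))` in the derived category. -/
noncomputable def singlePolyHomEquiv (s : ℕ) :
    ((singleFunctor (ModuleCat.{u} k[X]) 0).obj (poly k) ⟶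
      (singleFunctor (ModuleCat.{u} k[X]) 0).obj (quot k s)) ≃ₗ[k]
    k[X] ⧸ Ideal.span {(Polynomial.X : k[X]) ^ (s + 1)} :=
  (singleHomEquiv k (poly k) (quot k s)).symm.trans (polyHomEquiv k s)

lemma singlePolyHomEquiv_comp (r s : ℕ) (f : (singleFunctor (ModuleCat.{u} k[X]) 0).obj (poly k) ⟶
      (singleFunctor (ModuleCat.{u} k[X]) 0).obj (quot k s)) :
    singlePolyHomEquiv k s ((singleFunctor (ModuleCat.{u} k[X]) 0).map (polyMul k r) ≫ f) =
      mulXPow k r s (singlePolyHomEquiv k s f) := by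
  obtain ⟨f, rfl⟩ := (singleFunctor (ModuleCat.{u} k[X]) 0).map_surjective f
  have h (g : poly k ⟶ quot k s) :
      singlePolyHomEquiv k s ((singleFunctor (ModuleCat.{u} k[X]) 0).map g) = polyHomEquiv k s g :=
    congrArg (polyHomEquiv k s) ((singleHomEquiv k (poly k) (quot k s)).symm_apply_apply g)
  rw [← Functor.map_comp, h, h, polyHomEquiv_comp]

/-- Precomposition with multiplication by `T ^ (r + 1)`. -/
noncomputable def precompPolyMul (r s : ℕ) :
    ((singleFunctor (ModuleCat.{u} k[X]) 0).obj (poly k) ⟶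
      (singleFunctor (ModuleCat.{u} k[X]) 0).obj (quot k s)) →ₗ[k]
    ((singleFunctor (ModuleCat.{u} k[X]) 0).obj (poly k) ⟶
      (singleFunctor (ModuleCat.{u} k[X]) 0).obj (quot k s)) :=
  Linear.leftComp k _ ((singleFunctor (ModuleCat.{u} k[X]) 0).map (polyMul k r))

instance (s : ℕ) : Module.Finite k ((singleFunctor (ModuleCat.{u} k[X]) 0).obj (poly k) ⟶
      (singleFunctor (ModuleCat.{u} k[X]) 0).obj (quot k s)) :=
  Module.Finite.equiv (singlePolyHomEquiv k s).symm

lemma finrank_range_precompPolyMul (r s : ℕ) :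
    (min r s + 1) + Module.finrank k (LinearMap.range (precompPolyMul k r s)) =
      Module.finrank k ((singleFunctor (ModuleCat.{u} k[X]) 0).obj (poly k) ⟶
        (singleFunctor (ModuleCat.{u} k[X]) 0).obj (quot k s)) := by
  have h : (LinearMap.range (precompPolyMul k r s)).map (singlePolyHomEquiv k s).toLinearMap =
      LinearMap.range (mulXPow k r s) := by
    ext x
    constructor
    · rintro ⟨_, ⟨f, rfl⟩, rfl⟩
      exact ⟨_, (singlePolyHomEquiv_comp k r s f).symm⟩
    · rintro ⟨y, rfl⟩
      obtain ⟨f, rfl⟩ := (singlePolyHomEquiv k s).surjective y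
      exact ⟨_, ⟨f, rfl⟩, singlePolyHomEquiv_comp k r s f⟩
  rw [(singlePolyHomEquiv k s).finrank_eq, finrank_quotient_X_pow, ← finrank_range_mulXPow k r s,
    ← h, LinearEquiv.finrank_map_eq]

/-- Precomposition with `k[T] ⟶ X_r` embeds this space as the kernel of `T^(r+1)`; injectivity comes
from full faithfulness in degree zero. -/
lemma rank_hom_single (r s : ℕ) :
    Module.rank k ((singleFunctor (ModuleCat.{u} k[X]) 0).obj (quot k r) ⟶
      (singleFunctor (ModuleCat.{u} k[X]) 0).obj (quot k s)) = (min r s + 1 : ℕ) := by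
  let F := singleFunctor (ModuleCat.{u} k[X]) 0
  have hT := (poly_shortExact k r).singleTriangle_distinguished
  obtain ⟨_, h⟩ := Module.finite_and_finrank_of_ker (precompPolyMul k r s)
    (Linear.leftComp k (F.obj (quot k s)) (F.map (polyProj k r))) (by
      intro f g hfg
      obtain ⟨f, rfl⟩ := F.map_surjective f
      obtain ⟨g, rfl⟩ := F.map_surjective g
      change F.map (polyProj k r) ≫ F.map f = F.map (polyProj k r) ≫ F.map g at hfg
      rw [← F.map_comp, ← F.map_comp] at hfg
      rw [(cancel_epi _).1 (F.map_injective hfg)]) (by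
      ext f
      constructor
      · rintro ⟨g, rfl⟩
        change F.map (polyMul k r) ≫ F.map (polyProj k r) ≫ g = 0
        rw [← F.map_comp_assoc, polyMul_polyProj, F.map_zero, Limits.zero_comp]
      · intro hf
        obtain ⟨g, hg⟩ := Triangle.yoneda_exact₂ _ hT f hf
        exact ⟨g, hg.symm⟩)
  rw [← finrank_range_precompPolyMul k r s] at h
  rw [← Module.finrank_eq_rank, Nat.add_right_cancel h]

/-- The connecting map `δ` presents this space as the cokernel of `T^(r+1)`: `f` is sent to `δ ≫
f⟦1⟧`. -/
lemma rank_hom_single_shift (r s : ℕ) :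
    Module.rank k ((singleFunctor (ModuleCat.{u} k[X]) 0).obj (quot k r) ⟶
      ((singleFunctor (ModuleCat.{u} k[X]) 0).obj (quot k s))⟦(1 : ℤ)⟧) = (min r s + 1 : ℕ) := by
  let F := singleFunctor (ModuleCat.{u} k[X]) 0
  let D := DerivedCategory (ModuleCat.{u} k[X])
  have hT := (poly_shortExact k r).singleTriangle_distinguished
  let δ : F.obj (quot k r) ⟶ (F.obj (poly k))⟦(1 : ℤ)⟧ := (poly_shortExact k r).singleδ
  have hδ : δ ≫ (F.map (polyMul k r))⟦(1 : ℤ)⟧' = 0 := comp_distTriang_mor_zero₃₁ _ hT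
  obtain ⟨_, h⟩ := Module.finite_and_finrank_of_coker (precompPolyMul k r s)
    (Linear.leftComp k ((F.obj (quot k s))⟦(1 : ℤ)⟧) δ ∘ₗ
      (shiftFunctor D (1 : ℤ)).mapLinearMap k) (by
      intro f
      obtain ⟨g, hg⟩ := Triangle.yoneda_exact₃ _ hT f (by
        -- Surjectivity: the obstruction is a map `k[T] ⟶ Σ X_s`, and `H^0(Σ X_s) = H^1(X_s) = 0`.
        refine eq_zero_of_projective (P := poly k) ?_ _
        rw [isZero_homologyFunctor_shift_iff _ 1 0 1 (by lia)]
        exact isZero_homologyFunctor_single _ (by lia))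
      obtain ⟨g, rfl⟩ := (shiftFunctor D (1 : ℤ)).map_surjective g
      exact ⟨g, hg.symm⟩) (by
      ext f
      constructor
      · intro hf
        obtain ⟨g, hg⟩ := Triangle.yoneda_exact₃ _ (rot_of_distTriang _ hT)
          ((shiftFunctor D (1 : ℤ)).map f) hf
        obtain ⟨g, rfl⟩ := (shiftFunctor D (1 : ℤ)).map_surjective g
        change F.obj (poly k) ⟶ F.obj (quot k s) at g
        -- The sign cancels the one that rotating the triangle puts on the shifted first map.
        refine ⟨-g, (shiftFunctor D (1 : ℤ)).map_injective ?_⟩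
        refine Eq.trans ?_ hg.symm
        change (F.map (polyMul k r) ≫ (-g))⟦(1 : ℤ)⟧' =
          (-(F.map (polyMul k r))⟦(1 : ℤ)⟧') ≫ g⟦(1 : ℤ)⟧'
        rw [Functor.map_comp, Functor.map_neg, Preadditive.comp_neg, Preadditive.neg_comp]
      · rintro ⟨g, rfl⟩
        change δ ≫ (F.map (polyMul k r) ≫ g)⟦(1 : ℤ)⟧' = 0
        rw [Functor.map_comp, reassoc_of% hδ, Limits.zero_comp])
  rw [← finrank_range_precompPolyMul k r s] at h
  rw [← Module.finrank_eq_rank, Nat.add_right_cancel h]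

/-- The inclusion of `T` as a linear equivalence on morphisms. -/
noncomputable def homEquiv (Y Z : Cat.{w} k) : (Y ⟶ Z) ≃ₗ[k] (Y.obj ⟶ Z.obj) :=
  InducedCategory.homLinearEquiv

end Resolution

end OneSpherical

/-! ### The dimension formula -/

theorem mainTheorem6 (k : Type u) [Field k] [IsAlgClosed k]
    [HasDerivedCategory.{w} (ModuleCat.{u} (Polynomial k))]
    (r : ℕ) (U : OneSpherical.Cat.{w} k) (hU : Indecomposable U) :
    (∀ s : ℕ,
      (Nonempty (U ≅ OneSpherical.X k s) ∨
        Nonempty (U ≅ (OneSpherical.suspension k).obj (OneSpherical.X k s))) →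
      Module.rank k (OneSpherical.X k r ⟶ U) = ((min r s + 1 : ℕ) : Cardinal.{w})) ∧
    ((∀ s : ℕ,
      ¬ Nonempty (U ≅ OneSpherical.X k s) ∧
        ¬ Nonempty (U ≅ (OneSpherical.suspension k).obj (OneSpherical.X k s))) →
      Module.rank k (OneSpherical.X k r ⟶ U) = 0) := by
  refine ⟨?_, fun h ↦ ?_⟩
  · rintro s (⟨⟨e⟩⟩ | ⟨⟨e⟩⟩)
    · exact ((OneSpherical.homEquiv k _ _).trans (Linear.homCongr k (Iso.refl _)
        ((OneSpherical.thick k).ι.mapIso e))).rank_eq.trans (OneSpherical.rank_hom_single k r s)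
    · exact ((OneSpherical.homEquiv k _ _).trans (Linear.homCongr k (Iso.refl _)
        ((OneSpherical.thick k).ι.mapIso e ≪≫ OneSpherical.suspensionXIso s))).rank_eq.trans
          (OneSpherical.rank_hom_single_shift k r s)
  · rw [rank_eq_zero_iff]
    exact fun f ↦ ⟨1, one_ne_zero, by
      rw [OneSpherical.hom_eq_zero_of_indecomposable r U hU h f, smul_zero]⟩
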